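/- Let $S^1=\mathbb R/\mathbb Z$ be the circle of length $1$ with the arc-length metric, let $\delta\in(0,1)$, and let $\alpha\in(0,1)$ be irrational of Diophantine class $\nu\in[1,\infty]$; that is, writing $\|\cdot\|$ for the distance to the nearest integer, the inequality $\|q\alpha\|<q^{-\mu}$ has infinitely many positive integer solutions $q$ for every real $\mu<\nu$ and only finitely many for every real $\mu>\nu$. Let $f\colon S^1\to S^1$ be an orientation-preserving homeomorphism with rotation number $\alpha$ and let $\Omega_f$ be its minimal set. Suppose that $f$ is a Denjoy map of class $\delta$ in the following sense: $S^1\setminus\Omega_f=\bigcup_{n\in\mathbb Z}J_n$, where the $J_n$ are pairwise disjoint open arcs with $f(J_n)=J_{n+1}$ for all $n\in\mathbb Z$, and the lengths $\ell_n=|J_n|$ satisfy $$\sum_{n\in\mathbb Z}\ell_n=1\qquad\text{and}\qquad \liminf_{n\to\pm\infty}\frac{\ln|\ell_n-\ell_{n+1}|}{\ln \ell_n}=1+\delta ,$$ where the lower limit is taken as $|n|\to\infty$ and $\ln 0=-\infty$. (No smoothness of $f$ is required beyond these conditions; in particular the statement covers the $C^{1+\delta}$ Denjoy diffeomorphisms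 whose gap lengths satisfy them.) Then $$\dim_H(\Omega_f)\ \ge\ \frac{\delta}{\nu},$$ where $\delta/\infty=0$. -/

import Mathlib

open scoped ENNReal

namespace Denjoy

/-- A Denjoy sequence of class `δ`: nonnegative numbers `ℓ n`, `n ∈ ℤ`, with sum `1` and
`liminf_{n → ±∞} ln |ℓ n - ℓ (n+1)| / ln (ℓ n) = 1 + δ`.
The logarithms and the quotient are extended-real valued (`ln 0 = -∞`), so an index with
`ℓ n = ℓ (n+1) ∈ (0,1)` contributes the value `+∞`.  The filter `cofinite` on `ℤ` is `|n| → ∞`. -/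
structure IsDenjoySequence (δ : ℝ) (ℓ : ℤ → ℝ) : Prop where
  nonneg : ∀ n, 0 ≤ ℓ n
  hasSum : HasSum ℓ 1
  liminf_eq : Filter.liminf
    (fun n : ℤ => ENNReal.log (ENNReal.ofReal |ℓ n - ℓ (n + 1)|) /
      ENNReal.log (ENNReal.ofReal (ℓ n))) Filter.cofinite = ((1 + δ : ℝ) : EReal)

/-- `α` has Diophantine class `ν ∈ [1, ∞]`: the inequality `‖q α‖ < 1 / q ^ μ` has infinitely many
positive integral solutions `q` for every real `μ < ν`, and only finitely many for every real
`μ > ν`.  Here `‖·‖` is the distance to the nearest integer, which is the norm of `ℝ / ℤ`. -/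
def IsDiophantineClass (α : ℝ) (ν : ℝ≥0∞) : Prop :=
  1 ≤ ν ∧
  (∀ μ : ℝ, (μ : EReal) < (ν : EReal) →
    {q : ℕ | 0 < q ∧ ‖(((q : ℝ) * α : ℝ) : UnitAddCircle)‖ < 1 / (q : ℝ) ^ μ}.Infinite) ∧
  (∀ μ : ℝ, (ν : EReal) < (μ : EReal) →
    {q : ℕ | 0 < q ∧ ‖(((q : ℝ) * α : ℝ) : UnitAddCircle)‖ < 1 / (q : ℝ) ^ μ}.Finite)

/-- The circle homeomorphism `f` preserves orientation and has rotation number `α` (mod `1`):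
`f` has a lift `F` which is an increasing bijection of `ℝ` commuting with `x ↦ x + 1`
(these are the units of the monoid `CircleDeg1Lift`), and the translation number
`lim F^n(x) / n` of `F` is congruent to `α` modulo `1`. -/
def HasRotationNumber (f : UnitAddCircle ≃ₜ UnitAddCircle) (α : ℝ) : Prop :=
  ∃ F : CircleDeg1Liftˣ,
    (∀ x : ℝ, (((F : CircleDeg1Lift) x : ℝ) : UnitAddCircle) = f (x : UnitAddCircle)) ∧
    (((F : CircleDeg1Lift).translationNumber : ℝ) : UnitAddCircle) = (α : UnitAddCircle)

/-- `Ω` is a minimal set of `f`: a nonempty closed set mapped into itself by `f` which contains no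
smaller nonempty closed set mapped into itself. -/
structure IsMinimalSet {X : Type*} [TopologicalSpace X] (f : X → X) (Ω : Set X) : Prop where
  nonempty : Ω.Nonempty
  isClosed : IsClosed Ω
  mapsTo : Set.MapsTo f Ω Ω
  eq_of_subset : ∀ K : Set X, K ⊆ Ω → K.Nonempty → IsClosed K → Set.MapsTo f K K → K = Ω

/-- The open arc of length `L` starting at the point `a` (mod `1`), in the positive direction, of
the circle of length `1`. -/
def openArc (a L : ℝ) : Set UnitAddCircle :=
  (fun t : ℝ => (t : UnitAddCircle)) '' Set.Ioo a (a + L)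

/-- The gaps of `Ω` are the arcs `J n`, `n ∈ ℤ`, of lengths `ℓ n`, and `f` maps each
gap `J n` onto `J (n+1)`.  (Being pairwise disjoint open arcs that fill up the complement of `Ω`,
the `J n` are its connected components.) -/
structure HasGaps (f : UnitAddCircle ≃ₜ UnitAddCircle) (Ω : Set UnitAddCircle)
    (J : ℤ → Set UnitAddCircle) (ℓ : ℤ → ℝ) : Prop where
  isArc : ∀ n, ∃ a : ℝ, J n = openArc a (ℓ n)
  disjoint : Pairwise fun m n => Disjoint (J m) (J n)
  compl_eq : Ωᶜ = ⋃ n, J n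
  image_eq : ∀ n, f '' J n = J (n + 1)

/-- `f` is a Denjoy map with rotation number `α`, minimal set `Ω`, and wandering intervals `J n`
whose lengths `ℓ n` form a Denjoy sequence of class `δ`. -/
structure IsDenjoyMap (δ α : ℝ) (f : UnitAddCircle ≃ₜ UnitAddCircle) (Ω : Set UnitAddCircle)
    (J : ℤ → Set UnitAddCircle) (ℓ : ℤ → ℝ) : Prop where
  rotationNumber : HasRotationNumber f α
  minimalSet : IsMinimalSet f Ω
  gaps : HasGaps f Ω J ℓ
  denjoySequence : IsDenjoySequence δ ℓ

end Denjoy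

/-! A monotone degree-one map `H` semiconjugates `f` to the rotation and collapses each gap to a
point. So the image of `Ω` is the circle minus at most countably many points and has dimension 1; if
`H` is `θ`-Hölder, then `dimH Ω ≥ θ`.

Every `θ = s / μ` with `s < δ`, `μ > ν` works. The liminf condition makes `ℓ n ^ (-s)` grow at most
linearly along `n ≥ 0`, so `ℓ n` is at least of order `n ^ (-1/s)`. The Diophantine condition makes
rotation orbits hit every interval of length `r` within time of order `r ^ (-μ)`. If `H y - H x =
r`, some `J n` with such an `n` therefore lies between `x` and `y`, and `y - x ≥ ℓ n` is at least of
order `r ^ (μ / s)`. Finally `s → δ` and `μ → ν`. -/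

namespace Denjoy

open Filter Set

/-! ### Slow decay of sequences -/

/-- A positive sequence whose increments are at most `a n ^ (1 + s)` decays at most like
`n ^ (-1 / s)`. -/
theorem exists_rpow_le_of_abs_sub_le {s : ℝ} (hs : 0 < s) (hs1 : s ≤ 1) {a : ℕ → ℝ}
    (pos : ∀ n, 0 < a n)
    (h : ∀ᶠ n in atTop, a n ^ s ≤ 1 / 2 ∧ |a n - a (n + 1)| ≤ a n ^ (1 + s)) :
    ∃ c > 0, ∀ n : ℕ, c * ((n : ℝ) + 1) ^ (-(1 / s)) ≤ a n := by
  obtain ⟨N, hN⟩ := eventually_atTop.1 h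
  have step : ∀ n ≥ N, a (n + 1) ^ (-s) ≤ a n ^ (-s) + 2 := by
    intro n hn
    obtain ⟨h1, h2⟩ := hN n hn
    have hx : 0 < a n ^ s := Real.rpow_pos_of_pos (pos n) s
    have hle : a n * (1 - a n ^ s) ≤ a (n + 1) := by
      rw [Real.rpow_add (pos n), Real.rpow_one] at h2
      linarith [(abs_le.1 h2).2]
    have h1x : 0 < 1 - a n ^ s := by linarith
    calc a (n + 1) ^ (-s) ≤ (a n * (1 - a n ^ s)) ^ (-s) :=
          Real.rpow_le_rpow_of_nonpos (mul_pos (pos n) h1x) hle (by linarith)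
      _ = (a n ^ s)⁻¹ * (1 - a n ^ s) ^ (-s) := by
          rw [Real.mul_rpow (pos n).le h1x.le, Real.rpow_neg (pos n).le]
      -- Here `s ≤ 1` enters; with exponent `-1`, partial fractions split the product.
      _ ≤ (a n ^ s)⁻¹ * (1 - a n ^ s) ^ (-1 : ℝ) := by
          refine mul_le_mul_of_nonneg_left ?_ (inv_nonneg.2 hx.le)
          exact Real.rpow_le_rpow_of_exponent_ge h1x (by linarith) (by linarith)
      _ = (a n ^ s)⁻¹ + (1 - a n ^ s)⁻¹ := by
          rw [Real.rpow_neg_one]; field_simp; ring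
      _ ≤ (a n ^ s)⁻¹ + 2 := by
          gcongr
          exact inv_le_of_inv_le₀ (by norm_num) (by linarith)
      _ = a n ^ (-s) + 2 := by rw [Real.rpow_neg (pos n).le]
  have bpos : ∀ n, 0 < a n ^ (-s) := fun n => Real.rpow_pos_of_pos (pos n) _
  set C : ℝ := 2 + ∑ i ∈ Finset.range (N + 1), a i ^ (-s) with hC
  have hS : 0 ≤ ∑ i ∈ Finset.range (N + 1), a i ^ (-s) :=
    Finset.sum_nonneg fun i _ => (bpos i).le
  have hsmall : ∀ n ≤ N, a n ^ (-s) ≤ C * (n + 1) := by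
    intro n hn
    have h1 : a n ^ (-s) ≤ ∑ i ∈ Finset.range (N + 1), a i ^ (-s) :=
      Finset.single_le_sum (f := fun i => a i ^ (-s)) (fun i _ => (bpos i).le)
        (Finset.mem_range.2 (by omega))
    have h2 : (0 : ℝ) ≤ n := n.cast_nonneg
    nlinarith
  have hall : ∀ n, a n ^ (-s) ≤ C * (n + 1) := by
    intro n
    rcases le_total n N with hn | hn
    · exact hsmall n hn
    · induction n, hn using Nat.le_induction with
      | base => exact hsmall N le_rfl
      | succ n hn ih =>
        push_cast
        linarith [step n hn]
  have hC0 : 0 < C := by linarith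
  refine ⟨C ^ (-(1 / s)), Real.rpow_pos_of_pos hC0 _, fun n => ?_⟩
  have hn : (0 : ℝ) < (n : ℝ) + 1 := by positivity
  rw [← Real.mul_rpow hC0.le hn.le]
  calc (C * ((n : ℝ) + 1)) ^ (-(1 / s)) ≤ (a n ^ (-s)) ^ (-(1 / s)) :=
        Real.rpow_le_rpow_of_nonpos (bpos n) (hall n) (by simp [hs.le])
    _ = a n := by
        rw [← Real.rpow_mul (pos n).le]
        have : -s * -(1 / s) = 1 := by field_simp
        rw [this, Real.rpow_one]

/-! ### Diophantine approximation and density of rotation orbits -/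

theorem norm_natCast_mul_pos {α : ℝ} (hirr : Irrational α) {q : ℕ} (hq : 0 < q) :
    0 < ‖(((q : ℝ) * α : ℝ) : UnitAddCircle)‖ := by
  rw [UnitAddCircle.norm_eq, abs_pos, sub_ne_zero]
  exact (hirr.natCast_mul hq.ne').ne_int _

/-- A number of Diophantine class `ν` satisfies a uniform Diophantine condition with every exponent
larger than `ν`. -/
theorem IsDiophantineClass.exists_pos_mul_rpow_le {α : ℝ} {ν : ℝ≥0∞} (hirr : Irrational α)
    (h : IsDiophantineClass α ν) {μ : ℝ} (hμ : (ν : EReal) < (μ : EReal)) :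
    ∃ c > 0, ∀ q : ℕ, 0 < q →
      c * (q : ℝ) ^ (-μ) ≤ ‖(((q : ℝ) * α : ℝ) : UnitAddCircle)‖ := by
  set g : ℕ → ℝ := fun q => ‖(((q : ℝ) * α : ℝ) : UnitAddCircle)‖ * (q : ℝ) ^ μ
  have hg : ∀ q : ℕ, 0 < q → 0 < g q := fun q hq =>
    mul_pos (norm_natCast_mul_pos hirr hq) (Real.rpow_pos_of_pos (by exact_mod_cast hq) _)
  obtain ⟨c, hc, hcS⟩ : ∃ c > 0, ∀ q ∈ {q : ℕ | 0 < q ∧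
      ‖(((q : ℝ) * α : ℝ) : UnitAddCircle)‖ < 1 / (q : ℝ) ^ μ}, c ≤ g q := by
    rcases Set.eq_empty_or_nonempty {q : ℕ | 0 < q ∧
      ‖(((q : ℝ) * α : ℝ) : UnitAddCircle)‖ < 1 / (q : ℝ) ^ μ} with he | hne
    · exact ⟨1, one_pos, fun q hq => (he ▸ hq : q ∈ (∅ : Set ℕ)).elim⟩
    · obtain ⟨p, hp, hmin⟩ := Set.exists_min_image _ g (h.2.2 μ hμ) hne
      exact ⟨g p, hg p hp.1, hmin⟩
  refine ⟨min c 1, lt_min hc one_pos, fun q hq => ?_⟩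
  have hqμ : 0 < (q : ℝ) ^ μ := Real.rpow_pos_of_pos (by exact_mod_cast hq) _
  rw [Real.rpow_neg q.cast_nonneg, ← div_eq_mul_inv, div_le_iff₀ hqμ]
  by_cases hlt : ‖(((q : ℝ) * α : ℝ) : UnitAddCircle)‖ < 1 / (q : ℝ) ^ μ
  · exact (min_le_left _ _).trans (hcS q ⟨hq, hlt⟩)
  · rw [not_lt, div_le_iff₀ hqμ] at hlt
    exact (min_le_right _ _).trans hlt

/-- Quantitative density of the orbits of a rotation satisfying a Diophantine condition: every
interval of length `r` is hit within a time of order `r ^ (-μ)`. -/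
theorem exists_natCast_mul_add_intCast_mem_Ioo {τ c μ : ℝ} (hc : 0 < c) (hμ : 0 < μ)
    (h : ∀ q : ℕ, 0 < q → c * (q : ℝ) ^ (-μ) ≤ ‖(((q : ℝ) * τ : ℝ) : UnitAddCircle)‖) :
    ∃ C > 0, ∀ r : ℝ, 0 < r → r ≤ 1 → ∀ A : ℝ, ∃ n : ℕ, ∃ m : ℤ,
      (n : ℝ) + 1 ≤ C * r ^ (-μ) ∧ n * τ + m ∈ Ioo A (A + r) := by
  refine ⟨4 ^ μ / c + 1, by positivity, fun r hr hr1 A => ?_⟩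
  -- Chosen so that a Dirichlet approximation of order `Q ≥ X` must have denominator `k > 4 / r`: `c
  -- * k ^ (-μ) ≤ ‖k τ‖ ≤ 1 / (Q + 1) < 1 / X`.
  set X : ℝ := (4 / r) ^ μ / c with hX
  have hX0 : 0 < X := by positivity
  have hXle : X + 1 ≤ (4 ^ μ / c + 1) * r ^ (-μ) := by
    have h1 : 1 ≤ r ^ (-μ) := Real.one_le_rpow_of_pos_of_le_one_of_nonpos hr hr1 (by linarith)
    have h2 : X = 4 ^ μ / c * r ^ (-μ) := by
      rw [hX, Real.div_rpow (by norm_num) hr.le, Real.rpow_neg hr.le]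
      field_simp
    linarith
  obtain ⟨p, hp, hpQ⟩ := Real.exists_rat_abs_sub_le_and_den_le τ (Nat.ceil_pos.2 hX0)
  set Q : ℕ := ⌈X⌉₊
  set k : ℕ := p.den
  have hk : (0 : ℝ) < k := by exact_mod_cast p.den_pos
  have hpk : (p : ℝ) = p.num / k := Rat.cast_def p
  have hkQ : (k : ℝ) ≤ Q := by exact_mod_cast hpQ
  have hXQ : X ≤ Q := Nat.le_ceil X
  have hkp : k * |τ - p| ≤ 1 / (Q + 1) := by
    calc k * |τ - p| ≤ k * (1 / ((Q + 1) * k)) := by gcongr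
      _ = 1 / (Q + 1) := by field_simp
  have hk4 : 4 / r < k := by
    have h1 : ‖(((k : ℝ) * τ : ℝ) : UnitAddCircle)‖ ≤ k * |τ - p| := by
      rw [UnitAddCircle.norm_eq]
      calc |k * τ - round (k * τ)| ≤ |k * τ - p.num| := round_le _ _
        _ = |k * (τ - p)| := by rw [hpk]; congr 1; field_simp
        _ = k * |τ - p| := by rw [abs_mul, abs_of_pos hk]
    have h2 := (h k p.den_pos).trans (h1.trans hkp)
    rw [Real.rpow_neg hk.le, ← div_eq_mul_inv, div_le_div_iff₀ (by positivity) (by positivity),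
      one_mul] at h2
    refine lt_of_not_ge fun hle => ?_
    have h3 : (k : ℝ) ^ μ ≤ (4 / r) ^ μ := Real.rpow_le_rpow hk.le hle hμ.le
    have h4 : (4 / r) ^ μ = c * X := by rw [hX]; field_simp
    nlinarith
  have hkr : 1 / (k : ℝ) < r / 4 := by
    rw [div_lt_iff₀ hr] at hk4
    rw [div_lt_iff₀ hk]; linarith
  -- `t / k` is within `r / 4` of the midpoint. Coprimality gives `0 ≤ n < k` with `n * p + m = t /
  -- k`, and replacing `p` by `τ` costs less than another `r / 4`.
  set t : ℤ := ⌊(A + r / 2) * k⌋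
  obtain ⟨u, v, huv⟩ : IsCoprime p.num (k : ℤ) := by
    rw [Int.isCoprime_iff_nat_coprime]; exact p.reduced
  have hkz : (0 : ℤ) < k := by exact_mod_cast p.den_pos
  obtain ⟨n, hn⟩ := Int.eq_ofNat_of_zero_le (Int.emod_nonneg (t * u) hkz.ne')
  have hnk : (n : ℤ) < k := hn ▸ Int.emod_lt_of_pos _ hkz
  have hnk' : (n : ℝ) + 1 ≤ k := by exact_mod_cast hnk
  obtain ⟨m, hm⟩ : ∃ m : ℤ, n * p.num + m * k = t := by
    refine ⟨t * u / k * p.num + t * v, ?_⟩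
    have h1 := Int.emod_add_mul_ediv (t * u) k
    rw [hn] at h1
    linear_combination p.num * h1 + t * huv
  have hm' : (n : ℝ) * p.num + m * k = t := by exact_mod_cast hm
  refine ⟨n, m, ?_, ?_⟩
  · linarith [Nat.ceil_lt_add_one hX0.le]
  · have e1 : n * τ + m = n * (τ - p) + t / k := by
      rw [← hm', hpk]; field_simp; ring
    have e2 : |n * (τ - p)| < r / 4 := by
      rw [abs_mul, Nat.abs_cast]
      have h1 : 1 / ((Q : ℝ) + 1) ≤ 1 / k := one_div_le_one_div_of_le hk (by linarith)
      have h2 : n * |τ - p| ≤ k * |τ - p| := by gcongr; linarith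
      linarith
    have e3 : (t : ℝ) / k ≤ A + r / 2 := by
      rw [div_le_iff₀ hk]; exact Int.floor_le _
    have e4 : A + r / 2 < t / k + 1 / k := by
      rw [← add_div, lt_div_iff₀ hk]; exact Int.lt_floor_add_one _
    have e5 := abs_lt.1 e2
    rw [e1]
    constructor <;> linarith

/-! ### Gap lengths of a Denjoy map -/

theorem IsDenjoySequence.eventually_abs_sub_le {δ s : ℝ} {ℓ : ℤ → ℝ} (h : IsDenjoySequence δ ℓ)
    (pos : ∀ n, 0 < ℓ n) (hs : 0 < s) (hsδ : s < δ) :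
    ∀ᶠ n in cofinite, ℓ n ^ s ≤ 1 / 2 ∧ |ℓ n - ℓ (n + 1)| ≤ ℓ n ^ (1 + s) := by
  have hlim : Tendsto ℓ cofinite (nhds 0) := h.hasSum.summable.tendsto_cofinite_zero
  have hlim' : Tendsto (fun n => ℓ n ^ s) cofinite (nhds 0) := by
    simpa [hs.ne'] using hlim.rpow_const (Or.inr hs.le)
  have hlog : ((1 + s : ℝ) : EReal) < Filter.liminf
      (fun n : ℤ => ENNReal.log (ENNReal.ofReal |ℓ n - ℓ (n + 1)|) /
        ENNReal.log (ENNReal.ofReal (ℓ n))) cofinite := by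
    rw [h.liminf_eq, EReal.coe_lt_coe_iff]; linarith
  filter_upwards [hlim.eventually_lt_const one_pos, hlim'.eventually_le_const (show (0 : ℝ) < 1 / 2 by norm_num),
    eventually_lt_of_lt_liminf hlog] with n h1 h2 h3
  refine ⟨h2, ?_⟩
  rcases (abs_nonneg (ℓ n - ℓ (n + 1))).eq_or_lt with h0 | h0
  · rw [← h0]; exact Real.rpow_nonneg (pos n).le _
  · rw [ENNReal.log_ofReal_of_pos h0, ENNReal.log_ofReal_of_pos (pos n), ← EReal.coe_div,
      EReal.coe_lt_coe_iff, lt_div_iff_of_neg (Real.log_neg (pos n) h1)] at h3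
    rw [← Real.log_le_log_iff h0 (Real.rpow_pos_of_pos (pos n) _), Real.log_rpow (pos n)]
    exact h3.le

theorem HasGaps.nonempty_iff {f : UnitAddCircle ≃ₜ UnitAddCircle} {Ω : Set UnitAddCircle}
    {J : ℤ → Set UnitAddCircle} {ℓ : ℤ → ℝ} (h : HasGaps f Ω J ℓ) (n : ℤ) :
    (J n).Nonempty ↔ 0 < ℓ n := by
  obtain ⟨a, ha⟩ := h.isArc n
  rw [ha, openArc, Set.image_nonempty, Set.nonempty_Ioo, lt_add_iff_pos_right]

/-- Since `f` permutes the gaps, one empty gap would make all of them empty, contradicting total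
length 1. -/
theorem IsDenjoyMap.length_pos {δ α : ℝ} {f : UnitAddCircle ≃ₜ UnitAddCircle}
    {Ω : Set UnitAddCircle} {J : ℤ → Set UnitAddCircle} {ℓ : ℤ → ℝ}
    (h : IsDenjoyMap δ α f Ω J ℓ) (n : ℤ) : 0 < ℓ n := by
  have hiff : ∀ n : ℤ, (J (n + 1)).Nonempty ↔ (J n).Nonempty := fun n => by
    rw [← h.gaps.image_eq, Set.image_nonempty]
  have hall : ∀ n : ℤ, (J n).Nonempty ↔ (J 0).Nonempty := by
    intro n
    induction n using Int.induction_on with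
    | zero => rfl
    | succ n ih => rw [hiff, ih]
    | pred n ih => rw [← hiff, sub_add_cancel, ih]
  rw [← h.gaps.nonempty_iff, hall]
  by_contra h0
  have hz : ∀ n, ℓ n = 0 := fun n =>
    le_antisymm (not_lt.1 fun hn => h0 ((hall n).1 ((h.gaps.nonempty_iff n).2 hn)))
      (h.denjoySequence.nonneg n)
  have := h.denjoySequence.hasSum
  rw [show ℓ = fun _ => 0 from funext hz] at this
  exact zero_ne_one (hasSum_zero.unique this)

theorem HasGaps.iterate_mem {f : UnitAddCircle ≃ₜ UnitAddCircle} {Ω : Set UnitAddCircle}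
    {J : ℤ → Set UnitAddCircle} {ℓ : ℤ → ℝ} (h : HasGaps f Ω J ℓ) {j : ℤ} {x : UnitAddCircle}
    (hx : x ∈ J j) (n : ℕ) : f^[n] x ∈ J (j + n) := by
  induction n with
  | zero => simpa using hx
  | succ n ih =>
    rw [Function.iterate_succ_apply', Nat.cast_succ, ← add_assoc, ← h.image_eq]
    exact mem_image_of_mem f ih

/-! ### Semiconjugacy to the rotation -/

section Semiconjugacy

variable {f : UnitAddCircle ≃ₜ UnitAddCircle} {Ω : Set UnitAddCircle} {J : ℤ → Set UnitAddCircle}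
  {ℓ : ℤ → ℝ} {F H : CircleDeg1Lift} {τ : ℝ}

theorem coe_iterate_lift (hF : ∀ x : ℝ, ((F x : ℝ) : UnitAddCircle) = f x) (n : ℕ) (x : ℝ) :
    ((F^[n] x : ℝ) : UnitAddCircle) = f^[n] x := by
  induction n with
  | zero => rfl
  | succ n ih => rw [Function.iterate_succ_apply', Function.iterate_succ_apply', hF, ih]

theorem map_iterate_lift (hH : ∀ x, H (F x) = H x + τ) (n : ℕ) (x : ℝ) :
    H (F^[n] x) = H x + n * τ := by
  induction n with
  | zero => simp
  | succ n ih => rw [Function.iterate_succ_apply', hH, ih]; push_cast; ring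

theorem coe_add_intCast (x : ℝ) (m : ℤ) : ((x + m : ℝ) : UnitAddCircle) = x := by
  have : ((m : ℝ) : UnitAddCircle) = 0 := (AddCircle.coe_eq_zero_iff 1).2 ⟨m, by simp⟩
  rw [AddCircle.coe_add, this, add_zero]

/-- A semiconjugacy to an irrational rotation is constant on every gap. -/
theorem HasGaps.map_eq_of_mem (hg : HasGaps f Ω J ℓ)
    (hF : ∀ x : ℝ, ((F x : ℝ) : UnitAddCircle) = f x) (hH : ∀ x, H (F x) = H x + τ)
    (hd : ∀ A B : ℝ, A < B → ∃ n : ℕ, ∃ m : ℤ, 0 < n ∧ n * τ + m ∈ Ioo A B)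
    {n : ℤ} {a u v : ℝ} (ha : J n = openArc a (ℓ n)) (hu : u ∈ Ioo a (a + ℓ n))
    (hv : v ∈ Ioo a (a + ℓ n)) : H u = H v := by
  wlog huv : u ≤ v generalizing u v
  · exact (this hv hu (le_of_not_ge huv)).symm
  refine le_antisymm (H.monotone huv) (not_lt.1 fun hlt => ?_)
  -- A return with `k > 0` puts a translate of `F^[k] u` between `u` and `v`, hence in both `J n`
  -- and `J (n + k)`: gaps wander.
  obtain ⟨k, m, hk, hkm⟩ := hd 0 (H v - H u) (sub_pos.2 hlt)
  have hw : H (F^[k] u + m) = H u + (k * τ + m) := by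
    rw [H.map_add_int, map_iterate_lift hH, add_assoc]
  have h1 : u < F^[k] u + m := H.monotone.reflect_lt (by rw [hw]; linarith [hkm.1])
  have h2 : F^[k] u + m < v := H.monotone.reflect_lt (by rw [hw]; linarith [hkm.2])
  have hm : ((F^[k] u + m : ℝ) : UnitAddCircle) ∈ J n := by
    rw [ha]; exact mem_image_of_mem _ ⟨hu.1.trans h1, h2.trans hv.2⟩
  have hm' : ((F^[k] u + m : ℝ) : UnitAddCircle) ∈ J (n + k) := by
    rw [coe_add_intCast, coe_iterate_lift hF]
    exact hg.iterate_mem (ha ▸ mem_image_of_mem _ hu) k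
  exact Set.disjoint_left.1 (hg.disjoint (show n ≠ n + k by omega)) hm hm'

/-- If the image of a gap lies strictly between `H x` and `H y`, then the gap lies between `x`
and `y`. -/
theorem HasGaps.length_le_sub (hg : HasGaps f Ω J ℓ)
    (hF : ∀ x : ℝ, ((F x : ℝ) : UnitAddCircle) = f x) (hH : ∀ x, H (F x) = H x + τ)
    (hd : ∀ A B : ℝ, A < B → ∃ n : ℕ, ∃ m : ℤ, 0 < n ∧ n * τ + m ∈ Ioo A B)
    {n : ℤ} {x y z : ℝ} (hz : (z : UnitAddCircle) ∈ J n) (hxz : H x < H z) (hzy : H z < H y) :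
    ℓ n ≤ y - x := by
  obtain ⟨a, ha⟩ := hg.isArc n
  obtain ⟨t, ht, htz⟩ : (z : UnitAddCircle) ∈ openArc a (ℓ n) := ha ▸ hz
  obtain ⟨k, hk⟩ : ∃ k : ℤ, k • (1 : ℝ) = z - t := (AddCircle.coe_eq_zero_iff 1).1 (by
    rw [AddCircle.coe_sub, sub_eq_zero]; exact htz.symm)
  have hzt : z = t + k := by
    rw [zsmul_eq_mul, mul_one] at hk; linarith
  have hsub : Ioo a (a + ℓ n) ⊆ Ioo (x - k) (y - k) := by
    intro u hu
    have h1 : H (u + k) = H z := by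
      rw [hzt, H.map_add_int, H.map_add_int, hg.map_eq_of_mem hF hH hd ha hu ht]
    have h2 : x < u + k := H.monotone.reflect_lt (h1 ▸ hxz)
    have h3 : u + k < y := H.monotone.reflect_lt (h1 ▸ hzy)
    constructor <;> linarith
  have := (Ioo_subset_Ioo_iff (ht.1.trans ht.2)).1 hsub
  linarith [this.1, this.2]

/-- The semiconjugacy to the rotation is Hölder continuous if the gaps visited by an orbit decay
slowly and orbits of the rotation are quantitatively dense. -/
theorem HasGaps.exists_holder (hg : HasGaps f Ω J ℓ)
    (hF : ∀ x : ℝ, ((F x : ℝ) : UnitAddCircle) = f x) (hH : ∀ x, H (F x) = H x + τ)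
    (hd : ∀ A B : ℝ, A < B → ∃ n : ℕ, ∃ m : ℤ, 0 < n ∧ n * τ + m ∈ Ioo A B)
    {s μ c C : ℝ} (hs : 0 < s) (hμ : 0 < μ) (hc : 0 < c) (hC : 0 < C)
    (hℓ : ∀ n : ℕ, c * ((n : ℝ) + 1) ^ (-(1 / s)) ≤ ℓ n)
    (hhit : ∀ r : ℝ, 0 < r → r ≤ 1 → ∀ A : ℝ, ∃ n : ℕ, ∃ m : ℤ,
      (n : ℝ) + 1 ≤ C * r ^ (-μ) ∧ n * τ + m ∈ Ioo A (A + r)) :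
    ∃ K > 0, ∀ x y : ℝ, x ≤ y → y ≤ x + 1 → H y - H x ≤ K * (y - x) ^ (s / μ) := by
  -- Inserting `n + 1 ≤ C * r ^ (-μ)` into the lower bound for `ℓ n` gives `D * r ^ (μ / s)`.
  set D : ℝ := c * C ^ (-(1 / s)) with hDdef
  have hD : 0 < D := by positivity
  refine ⟨(D ^ (s / μ))⁻¹, by positivity, fun x y hxy hyx => ?_⟩
  rcases (H.monotone hxy).eq_or_lt with heq | hlt
  · rw [heq, sub_self]
    have : 0 ≤ y - x := sub_nonneg.2 hxy
    positivity
  have hr1 : H y - H x ≤ 1 := by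
    have := H.monotone hyx
    rw [H.map_add_one] at this
    linarith
  set r : ℝ := H y - H x with hr
  have hr0 : 0 < r := sub_pos.2 hlt
  obtain ⟨z, hz⟩ : ∃ z : ℝ, (z : UnitAddCircle) ∈ J 0 := by
    have h0 : 0 < ℓ 0 := lt_of_lt_of_le (by positivity) (hℓ 0)
    obtain ⟨p, hp⟩ := (hg.nonempty_iff 0).2 h0
    obtain ⟨z, rfl⟩ := QuotientAddGroup.mk_surjective p
    exact ⟨z, hp⟩
  obtain ⟨n, m, hn, hnm⟩ := hhit r hr0 hr1 (H x - H z)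
  have hw : H (F^[n] z + m) = H z + (n * τ + m) := by
    rw [H.map_add_int, map_iterate_lift hH, add_assoc]
  have hmem : ((F^[n] z + m : ℝ) : UnitAddCircle) ∈ J n := by
    rw [coe_add_intCast, coe_iterate_lift hF]
    simpa using hg.iterate_mem hz n
  have hlen : ℓ n ≤ y - x := hg.length_le_sub hF hH hd hmem
    (by rw [hw]; linarith [hnm.1]) (by rw [hw]; linarith [hnm.2])
  have hDr : D * r ^ (μ / s) ≤ y - x := by
    refine le_trans ?_ ((hℓ n).trans hlen)
    have h1 : (C * r ^ (-μ)) ^ (-(1 / s)) ≤ ((n : ℝ) + 1) ^ (-(1 / s)) :=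
      Real.rpow_le_rpow_of_nonpos (by positivity) hn (by simp [hs.le])
    have h2 : (C * r ^ (-μ)) ^ (-(1 / s)) = C ^ (-(1 / s)) * r ^ (μ / s) := by
      rw [Real.mul_rpow hC.le (by positivity), ← Real.rpow_mul hr0.le]
      congr 2
      field_simp
    rw [hDdef, mul_assoc, ← h2]
    gcongr
  have hpow := Real.rpow_le_rpow (by positivity) hDr (show 0 ≤ s / μ by positivity)
  rw [Real.mul_rpow hD.le (by positivity), ← Real.rpow_mul hr0.le,
    show μ / s * (s / μ) = 1 by field_simp, Real.rpow_one] at hpow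
  rwa [inv_mul_eq_div, le_div_iff₀ (by positivity), mul_comm]

/-- The range contains a dense orbit, and a monotone map with dense range is continuous. -/
theorem surjective_of_semiconj (hH : ∀ x, H (F x) = H x + τ)
    (hd : ∀ A B : ℝ, A < B → ∃ n : ℕ, ∃ m : ℤ, 0 < n ∧ n * τ + m ∈ Ioo A B) :
    Function.Surjective H := by
  have hdense : DenseRange H := by
    refine dense_of_exists_between fun A B hAB => ?_
    obtain ⟨n, m, -, h⟩ := hd (A - H 0) (B - H 0) (by linarith)
    refine ⟨_, ⟨F^[n] 0 + m, rfl⟩, ?_⟩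
    rw [H.map_add_int, map_iterate_lift hH]
    constructor <;> linarith [h.1, h.2]
  exact (H.monotone.continuous_of_denseRange hdense).surjective H.tendsto_atTop H.tendsto_atBot

end Semiconjugacy

/-! ### Passage to the circle and Hausdorff dimension -/

/-- The degree one circle map induced by a lift. -/
noncomputable def circleMap (H : CircleDeg1Lift) : UnitAddCircle → UnitAddCircle :=
  Function.Periodic.lift (f := fun x : ℝ => ((H x : ℝ) : UnitAddCircle)) (c := 1) fun x => by
    simp only [H.map_add_one, AddCircle.coe_add, AddCircle.coe_period, add_zero]

theorem circleMap_coe (H : CircleDeg1Lift) (x : ℝ) :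
    circleMap H (x : UnitAddCircle) = ((H x : ℝ) : UnitAddCircle) :=
  rfl

theorem norm_coe_le_abs (x : ℝ) : ‖(x : UnitAddCircle)‖ ≤ |x| := by
  rw [UnitAddCircle.norm_eq]
  simpa using round_le x 0

theorem holderWith_circleMap {H : CircleDeg1Lift} {K θ : ℝ} (hK : 0 < K) (hθ : 0 < θ)
    (h : ∀ x y : ℝ, x ≤ y → y ≤ x + 1 → H y - H x ≤ K * (y - x) ^ θ) :
    HolderWith K.toNNReal θ.toNNReal (circleMap H) := by
  have habs : ∀ x y : ℝ, |x - y| ≤ 1 → |H x - H y| ≤ K * |x - y| ^ θ := by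
    intro x y hxy
    wlog hle : x ≤ y generalizing x y
    · rw [abs_sub_comm, abs_sub_comm x y]
      exact this y x (by rwa [abs_sub_comm]) (le_of_not_ge hle)
    rw [abs_sub_comm, abs_sub_comm x y, abs_of_nonneg (sub_nonneg.2 (H.monotone hle)),
      abs_of_nonneg (sub_nonneg.2 hle)]
    rw [abs_sub_comm, abs_of_nonneg (sub_nonneg.2 hle)] at hxy
    exact h x y hle (by linarith)
  intro p q
  obtain ⟨x, rfl⟩ := QuotientAddGroup.mk_surjective p
  obtain ⟨y, rfl⟩ := QuotientAddGroup.mk_surjective q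
  change edist (circleMap H (x : UnitAddCircle)) (circleMap H (y : UnitAddCircle)) ≤
    _ * edist (x : UnitAddCircle) (y : UnitAddCircle) ^ _
  -- The lift of the second point nearest to `x` realizes the circle distance as a real distance.
  rw [← coe_add_intCast y (round (x - y))]
  set y' : ℝ := y + round (x - y) with hy'
  have hd : dist (x : UnitAddCircle) (y' : UnitAddCircle) = |x - y'| := by
    rw [hy', coe_add_intCast, dist_eq_norm, ← AddCircle.coe_sub, UnitAddCircle.norm_eq]
    congr 1; ring
  have hle : |x - y'| ≤ 1 := by
    have := abs_sub_round (x - y)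
    rw [hy', ← sub_sub]; linarith
  rw [edist_dist, edist_dist, hd, circleMap_coe, circleMap_coe, dist_eq_norm, ← AddCircle.coe_sub,
    Real.coe_toNNReal θ hθ.le, ENNReal.ofReal_rpow_of_nonneg (abs_nonneg _) hθ.le,
    ← ENNReal.ofReal, ← ENNReal.ofReal_mul hK.le]
  exact ENNReal.ofReal_le_ofReal ((norm_coe_le_abs _).trans (habs x y' hle))

theorem one_le_dimH_univ_unitAddCircle : 1 ≤ dimH (univ : Set UnitAddCircle) := by
  have h1 : dimH ((fun p : UnitAddCircle => ‖p‖) '' univ) ≤ dimH (univ : Set UnitAddCircle) :=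
    lipschitzWith_one_norm.dimH_image_le univ
  refine le_trans ?_ h1
  have hsub : Ioo (0 : ℝ) (1 / 2) ⊆ (fun p : UnitAddCircle => ‖p‖) '' univ := by
    intro x hx
    refine ⟨(x : UnitAddCircle), mem_univ _, ?_⟩
    have := (AddCircle.norm_coe_eq_abs_iff (p := 1) (x := x) one_ne_zero).2 (by
      rw [abs_of_pos hx.1, abs_one]; exact hx.2.le)
    exact this.trans (abs_of_pos hx.1)
  refine le_trans ?_ (dimH_mono hsub)
  rw [Real.dimH_of_nonempty_interior (by rw [interior_Ioo]; exact ⟨1 / 4, by norm_num, by norm_num⟩)]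
  simp

theorem IsDenjoyMap.ofReal_div_le_dimH {δ α s μ : ℝ} {ν : ℝ≥0∞} (hδ : δ ≤ 1)
    (hirr : Irrational α) (hν : IsDiophantineClass α ν) {f : UnitAddCircle ≃ₜ UnitAddCircle}
    {Ω : Set UnitAddCircle} {J : ℤ → Set UnitAddCircle} {ℓ : ℤ → ℝ}
    (hf : IsDenjoyMap δ α f Ω J ℓ) (hs : 0 < s) (hsδ : s < δ) (hμ : 0 < μ)
    (hνμ : (ν : EReal) < (μ : EReal)) : ENNReal.ofReal (s / μ) ≤ dimH Ω := by
  obtain ⟨F, hF, hτ⟩ := hf.rotationNumber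
  set τ : ℝ := (F : CircleDeg1Lift).translationNumber with hτdef
  have hdio : ∀ q : ℕ, ‖(((q : ℝ) * τ : ℝ) : UnitAddCircle)‖ =
      ‖(((q : ℝ) * α : ℝ) : UnitAddCircle)‖ := fun q => by
    rw [← nsmul_eq_mul, ← nsmul_eq_mul, AddCircle.coe_nsmul, AddCircle.coe_nsmul, hτ]
  obtain ⟨c₀, hc₀, hq⟩ := hν.exists_pos_mul_rpow_le hirr hνμ
  obtain ⟨C, hC, hhit⟩ := exists_natCast_mul_add_intCast_mem_Ioo (τ := τ) hc₀ hμ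
    fun q hq0 => (hq q hq0).trans_eq (hdio q).symm
  have hd : ∀ A B : ℝ, A < B → ∃ n : ℕ, ∃ m : ℤ, 0 < n ∧ n * τ + m ∈ Ioo A B := by
    intro A B hAB
    -- Aiming at the interval shifted by `-τ` leaves one more step, so the time `n + 1` is positive.
    obtain ⟨n, m, -, h1, h2⟩ := hhit (min (B - A) 1) (lt_min (sub_pos.2 hAB) one_pos)
      (min_le_right _ _) (A - τ)
    refine ⟨n + 1, m, n.succ_pos, ?_⟩
    have := min_le_left (B - A) 1
    push_cast
    constructor <;> linarith
  obtain ⟨H, hH⟩ := CircleDeg1Lift.units_semiconj_of_translationNumber_eq (f₁ := F)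
    (f₂ := CircleDeg1Lift.translate (Multiplicative.ofAdd τ))
    (by rw [CircleDeg1Lift.translationNumber_translate])
  have hH' : ∀ x, H ((F : CircleDeg1Lift) x) = H x + τ := fun x => by
    rw [hH x, CircleDeg1Lift.translate_apply, add_comm]
  have hev : ∀ᶠ n : ℕ in atTop, ℓ n ^ s ≤ 1 / 2 ∧ |ℓ n - ℓ ((n + 1 : ℕ) : ℤ)| ≤ ℓ n ^ (1 + s) := by
    have h1 := hf.denjoySequence.eventually_abs_sub_le hf.length_pos hs hsδ
    rw [← Nat.cofinite_eq_atTop]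
    exact_mod_cast (Nat.cast_injective (R := ℤ)).tendsto_cofinite.eventually h1
  obtain ⟨c, hc, hℓ⟩ := exists_rpow_le_of_abs_sub_le (a := fun n : ℕ => ℓ n) hs
    (hsδ.le.trans hδ) (fun n => hf.length_pos n) hev
  obtain ⟨K, hK, hhol⟩ := hf.gaps.exists_holder hF hH' hd hs hμ hc hC hℓ hhit
  have hθ : 0 < s / μ := div_pos hs hμ
  have hholder := holderWith_circleMap hK hθ hhol
  have hcount : (circleMap H '' ⋃ n, J n).Countable := by
    rw [image_iUnion]
    refine countable_iUnion fun n => Set.Subsingleton.countable ?_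
    obtain ⟨a, ha⟩ := hf.gaps.isArc n
    rw [ha]
    rintro _ ⟨_, ⟨u, hu, rfl⟩, rfl⟩ _ ⟨_, ⟨v, hv, rfl⟩, rfl⟩
    simp only [circleMap_coe, hf.gaps.map_eq_of_mem hF hH' hd ha hu hv]
  have huniv : (univ : Set UnitAddCircle) = circleMap H '' Ω ∪ circleMap H '' ⋃ n, J n := by
    rw [← image_union, ← hf.gaps.compl_eq, union_compl_self, image_univ, eq_comm, range_eq_univ]
    intro p
    obtain ⟨y, rfl⟩ := QuotientAddGroup.mk_surjective p
    obtain ⟨x, rfl⟩ := surjective_of_semiconj hH' hd y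
    exact ⟨(x : UnitAddCircle), rfl⟩
  have h1 : 1 ≤ dimH (circleMap H '' Ω) := by
    have := one_le_dimH_univ_unitAddCircle
    rwa [huniv, dimH_union, dimH_countable hcount, max_eq_left zero_le] at this
  have h2 := h1.trans (hholder.dimH_image_le (Real.toNNReal_pos.2 hθ) Ω)
  rw [ENNReal.le_div_iff_mul_le (Or.inl (by simpa using hθ)) (Or.inl ENNReal.coe_ne_top),
    one_mul] at h2
  exact h2

end Denjoy

theorem mainTheorem3 (δ α : ℝ) (ν : ℝ≥0∞)
    (hδ : δ ∈ Set.Ioo (0 : ℝ) 1) (hα : α ∈ Set.Ioo (0 : ℝ) 1) (hirr : Irrational α)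
    (hν : Denjoy.IsDiophantineClass α ν)
    (f : UnitAddCircle ≃ₜ UnitAddCircle) (Ω : Set UnitAddCircle)
    (J : ℤ → Set UnitAddCircle) (ℓ : ℤ → ℝ)
    (hf : Denjoy.IsDenjoyMap δ α f Ω J ℓ) :
    ENNReal.ofReal δ / ν ≤ dimH Ω := by
  rcases eq_or_ne ν ⊤ with rfl | hνtop
  · simp
  obtain ⟨N, rfl⟩ : ∃ N : NNReal, (N : ℝ≥0∞) = ν := ⟨ν.toNNReal, ENNReal.coe_toNNReal hνtop⟩
  have hN : (0 : ℝ) < N := by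
    have : (1 : NNReal) ≤ N := by exact_mod_cast hν.1
    exact_mod_cast one_pos.trans_le this
  -- Take `s = t * δ` and `μ = ν / t`, with `t → 1` from below.
  have hlim : Filter.Tendsto (fun t : ℝ => ENNReal.ofReal (t * δ / (N / t)))
      (nhdsWithin 1 (Set.Iio 1)) (nhds (ENNReal.ofReal δ / N)) := by
    have hcont : ContinuousAt (fun t : ℝ => t * δ / (N / t)) 1 := by
      refine ContinuousAt.div (by fun_prop) ?_ (by simpa using hN.ne')
      exact continuousAt_const.div continuousAt_id one_ne_zero
    have h1 := (ENNReal.continuous_ofReal.tendsto _).comp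
      (hcont.tendsto.mono_left (nhdsWithin_le_nhds (s := Set.Iio 1)))
    simpa [ENNReal.ofReal_div_of_pos hN, Function.comp_def] using h1
  refine le_of_tendsto hlim ?_
  filter_upwards [Ioo_mem_nhdsLT (zero_lt_one' ℝ)] with t ht
  refine hf.ofReal_div_le_dimH hδ.2.le hirr hν (mul_pos ht.1 hδ.1)
    (mul_lt_of_lt_one_left hδ.1 ht.2) (div_pos hN ht.1) ?_
  have h2 : (N : ℝ) < N / t := by rw [lt_div_iff₀ ht.1]; exact mul_lt_of_lt_one_right hN ht.2
  exact EReal.coe_lt_coe_iff.2 h2
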